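/- **Notation.** Let $\hat{\mathcal O}_2=\mathbb C[[x,y]]$, let $\hat K_2$ be its field of fractions (the formal meromorphic functions), let $\mathfrak m$ be the maximal ideal of $\hat{\mathcal O}_2$, and let $\widehat{\mathrm{Diff}}(\mathbb C^2,0)$ be the group of formal diffeomorphisms fixing the origin. Let $\mathrm{Diff}_{\mathrm{Id}}(\mathbb C^2,0)$ be the subgroup of its elements that are convergent (germs of holomorphic diffeomorphisms) and tangent to the identity. A formal vector field is $\hat X=a\,\partial_x+b\,\partial_y$ with $a,b\in\mathfrak m$, and $$\exp(t\hat X)=\Big(\sum_{j\ge0}\tfrac{t^j}{j!}\hat X^j(x),\ \sum_{j\ge0}\tfrac{t^j}{j!}\hat X^j(y)\Big).$$ For a subgroup $G$ tangent to the identity, let $G_k$ be the smallest algebraic subgroup of $\mathrm{GL}(\mathfrak m/\mathfrak m^{k+1})$ containing the maps $h_k:[\varphi]\mapsto[\varphi\circ h]$, $h\in G$. Let $\overline G$ be the group of all $h\in\widehat{\mathrm{Diff}}(\mathbb C^2,0)$ with $h_k\in G_k$ for every $k$. The (associate) Lie algebra of $G$ is $$\log(G)=\{\hat X:\ \exp(t\hat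 X)\in\overline G\ \text{ for all } t\in\mathbb C\}.$$ A formal vector field $\hat X$ is $G$-invariant if $g_*\hat X=\hat X$ for all $g\in G$; a one-form $\omega$ is $G$-invariant if $g^*\omega=\omega$ for all $g\in G$. **Theorem.** Let $G<\mathrm{Diff}_{\mathrm{Id}}(\mathbb C^2,0)$ be an abelian subgroup. Then at least one of the following holds. * (i) $G$ leaves invariant an exact one-form $dT\neq0$ with $T\in\hat K_2$. * (ii) $G$ embeds into the flow of a formal vector field $\hat X\in\log(G)$: every $g\in G$ is $\exp(t\hat X)$ for some $t\in\mathbb C$. * (iii) There are two commuting $G$-invariant formal vector fields $\hat X,\hat Y\in\log(G)$ that are linearly independent over $\hat K_2$. Moreover, at least one of the following also holds: (i$'$) $G$ leaves invariant an exact one-form $dT\ne0$ with $T\in\mathbb C(x,y)$ a quotient of polynomials; or (ii) above; or (iii$'$) there are two commuting $G$-invariant formal vector fields $\hat X,\hat Y\in\log(G)$ that are linearly independent over $\mathbb C$. -/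

import Mathlib

open MvPowerSeries

/-! ### Formal power series and formal meromorphic functions at the origin of `ℂⁿ` -/

/-- The ring `ℂ⟦z₁, …, zₙ⟧` of formal power series, the formal completion of the ring of germs at
the origin of holomorphic functions of `n` variables. -/
abbrev FormalSeries (n : ℕ) : Type := MvPowerSeries (Fin n) ℂ

/-- The field of formal meromorphic functions, the field of fractions of `ℂ⟦z₁, …, zₙ⟧`. -/
abbrev FormalMero (n : ℕ) : Type := FractionRing (FormalSeries n)

/-- A formal power series is convergent (the Taylor series of a germ of holomorphic function) when
its coefficients grow at most geometrically, i.e. it converges absolutely on a polydisc. -/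
def IsConvergent {n : ℕ} (φ : FormalSeries n) : Prop :=
  ∃ C r : ℝ, ∀ d : Fin n →₀ ℕ, ‖coeff d φ‖ ≤ C * r ^ d.degree

/-- `T` is a rational function of `z₁, …, zₙ`, i.e. a quotient of two polynomials. -/
def IsRationalFunction {n : ℕ} (T : FormalMero n) : Prop :=
  ∃ p q : MvPolynomial (Fin n) ℂ, q ≠ 0 ∧
    T = algebraMap (FormalSeries n) (FormalMero n) (p : FormalSeries n) /
      algebraMap (FormalSeries n) (FormalMero n) (q : FormalSeries n)

/-! ### Formal diffeomorphisms -/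

/-- Formal self-maps `f = (f₁, …, fₙ)` of `(ℂⁿ, 0)`: tuples of power series vanishing at `0`. -/
@[ext]
structure FormalMap (n : ℕ) where
  /-- the components of the map -/
  comp : Fin n → FormalSeries n
  constantCoeff_comp : ∀ i, constantCoeff (comp i) = 0

namespace FormalMap

variable {n : ℕ}

theorem hasSubst (f : FormalMap n) : HasSubst f.comp :=
  hasSubst_of_constantCoeff_zero f.constantCoeff_comp

/-- The ring endomorphism `φ ↦ φ ∘ f` of the ring of formal power series. -/
noncomputable def pull (f : FormalMap n) : FormalSeries n →ₐ[ℂ] FormalSeries n :=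
  substAlgHom f.hasSubst

theorem pull_eq (f : FormalMap n) (φ : FormalSeries n) : f.pull φ = subst f.comp φ :=
  substAlgHom_apply f.hasSubst φ

theorem constantCoeff_pull (f : FormalMap n) {φ : FormalSeries n} (h : constantCoeff φ = 0) :
    constantCoeff (f.pull φ) = 0 := by
  rw [pull_eq]
  exact constantCoeff_subst_eq_zero f.hasSubst f.constantCoeff_comp h

/-- Formal self-maps form a monoid under composition: `f * g = f ∘ g`. -/
noncomputable instance : Mul (FormalMap n) where
  mul f g := ⟨fun i => g.pull (f.comp i), fun i => g.constantCoeff_pull (f.constantCoeff_comp i)⟩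

noncomputable instance : One (FormalMap n) where
  one := ⟨fun i => X i, fun i => constantCoeff_X i⟩

theorem mul_comp (f g : FormalMap n) (i : Fin n) : (f * g).comp i = g.pull (f.comp i) := rfl

theorem one_comp (i : Fin n) : (1 : FormalMap n).comp i = X i := rfl

theorem pull_mul (f g : FormalMap n) (φ : FormalSeries n) :
    (f * g).pull φ = g.pull (f.pull φ) := by
  rw [pull_eq, pull_eq, pull_eq, subst_comp_subst_apply f.hasSubst g.hasSubst]
  congr 1
  funext i
  rw [mul_comp, pull_eq]

theorem pull_one (φ : FormalSeries n) : (1 : FormalMap n).pull φ = φ := by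
  rw [pull_eq]
  exact congrFun subst_self φ

noncomputable instance : Monoid (FormalMap n) where
  mul_assoc f g h := by
    ext1
    funext i
    simp only [mul_comp, pull_mul]
  one_mul f := by
    ext1
    funext i
    rw [mul_comp, one_comp, pull_eq, subst_X f.hasSubst]
  mul_one f := by
    ext1
    funext i
    rw [mul_comp, pull_one]

end FormalMap

/-- The group of formal diffeomorphisms of `(ℂⁿ, 0)`: the formal self-maps that are invertible for
composition. -/
abbrev FormalDiff (n : ℕ) : Type := (FormalMap n)ˣ

namespace FormalDiff

variable {n : ℕ}

/-- The ring automorphism `φ ↦ φ ∘ g` of the ring of formal power series. -/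
noncomputable def pullEquiv (g : FormalDiff n) : FormalSeries n ≃ₐ[ℂ] FormalSeries n :=
  AlgEquiv.ofAlgHom (FormalMap.pull g.1) (FormalMap.pull (g⁻¹).1)
    (by
      ext1 φ
      change FormalMap.pull g.1 (FormalMap.pull (g⁻¹).1 φ) = φ
      rw [← FormalMap.pull_mul, Units.inv_mul, FormalMap.pull_one])
    (by
      ext1 φ
      change FormalMap.pull (g⁻¹).1 (FormalMap.pull g.1 φ) = φ
      rw [← FormalMap.pull_mul, Units.mul_inv, FormalMap.pull_one])

/-- The field automorphism `T ↦ T ∘ g` of the field of formal meromorphic functions. -/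
noncomputable def pullMero (g : FormalDiff n) : FormalMero n ≃+* FormalMero n :=
  IsFractionRing.ringEquivOfRingEquiv (pullEquiv g).toRingEquiv

/-- `g` is (the Taylor expansion of) a germ of complex diffeomorphism. -/
def Convergent (g : FormalDiff n) : Prop := ∀ i, IsConvergent (g.1.comp i)

/-- `g` is tangent to the identity: its Jacobian matrix at the origin is the identity. -/
def TangentToId (g : FormalDiff n) : Prop :=
  ∀ i j, coeff (Finsupp.single j 1) (g.1.comp i) = (1 : Matrix (Fin n) (Fin n) ℂ) i j

end FormalDiff

/-! ### Formal vector fields -/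

/-- Formal vector fields `X = a₁ ∂/∂z₁ + ⋯ + aₙ ∂/∂zₙ` vanishing at the origin, identified with the
tuple of their components `aᵢ`. -/
def formalVectorFields (n : ℕ) : Submodule ℂ (Fin n → FormalSeries n) where
  carrier := {a | ∀ i, constantCoeff (a i) = 0}
  add_mem' ha hb i := by simp [ha i, hb i]
  zero_mem' i := by simp
  smul_mem' c a ha i := by
    have h := ha i
    simp only [Pi.smul_apply, ← coeff_zero_eq_constantCoeff_apply, coeff_smul] at h ⊢
    rw [h, mul_zero]

/-- The type of formal vector fields vanishing at the origin. -/
abbrev FormalVectorField (n : ℕ) : Type := ↥(formalVectorFields n)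

namespace FormalVectorField

variable {n : ℕ}

/-- The derivation `φ ↦ X(φ) = ∑ aᵢ ∂φ/∂zᵢ`. -/
noncomputable def apply (X : FormalVectorField n) (φ : FormalSeries n) : FormalSeries n :=
  ∑ i, X.1 i * pderiv ℂ i φ

/-- The components of the Lie bracket `[X, Y]`. -/
noncomputable def bracket (X Y : FormalVectorField n) : Fin n → FormalSeries n :=
  fun i => X.apply (Y.1 i) - Y.apply (X.1 i)

/-- The components of the push-forward `g_* X = (Dg · X) ∘ g⁻¹`. -/
noncomputable def pushforward (g : FormalDiff n) (X : FormalVectorField n) :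
    Fin n → FormalSeries n :=
  fun i => FormalMap.pull (g⁻¹).1 (X.apply (g.1.comp i))

/-- `X` is invariant by the group `G`: `g_* X = X` for all `g ∈ G`. -/
def IsInvariant (G : Subgroup (FormalDiff n)) (X : FormalVectorField n) : Prop :=
  ∀ g ∈ G, pushforward g X = X.1

/-- `g = exp (t X)`: the `i`-th component of `g` is `∑ⱼ (tʲ / j!) Xʲ(zᵢ)`, where the series of
formal power series is summed coefficient by coefficient. -/
def IsExp (t : ℂ) (X : FormalVectorField n) (g : FormalDiff n) : Prop :=
  ∀ (i : Fin n) (d : Fin n →₀ ℕ),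
    HasSum (fun j : ℕ => t ^ j / (j.factorial : ℂ) * coeff d (X.apply^[j] (MvPowerSeries.X i)))
      (coeff d (g.1.comp i))

/-- The components of `X` viewed in the field of formal meromorphic functions. -/
noncomputable def toMero (X : FormalVectorField n) : Fin n → FormalMero n :=
  fun i => algebraMap (FormalSeries n) (FormalMero n) (X.1 i)

end FormalVectorField

/-! ### The Lie algebra associated with a group of formal diffeomorphisms -/

/-- The maximal ideal `𝔪` of `ℂ⟦z₁, …, zₙ⟧`: the power series vanishing at the origin. -/
noncomputable def maxIdeal (n : ℕ) : Ideal (FormalSeries n) :=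
  RingHom.ker (constantCoeff (σ := Fin n) (R := ℂ))

/-- The space `𝔪 / 𝔪ᵏ⁺¹` of `k`-jets. -/
abbrev JetSpace (n k : ℕ) : Type :=
  ↥((maxIdeal n).restrictScalars ℂ) ⧸
    ((maxIdeal n ^ (k + 1)).restrictScalars ℂ).submoduleOf ((maxIdeal n).restrictScalars ℂ)

namespace FormalMap

variable {n : ℕ}

theorem maxIdeal_le_comap (f : FormalMap n) : maxIdeal n ≤ (maxIdeal n).comap f.pull :=
  fun _ h => f.constantCoeff_pull h

theorem maxIdeal_pow_le_comap (f : FormalMap n) (k : ℕ) :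
    maxIdeal n ^ k ≤ (maxIdeal n ^ k).comap f.pull :=
  (Ideal.pow_right_mono f.maxIdeal_le_comap k).trans (Ideal.le_comap_pow f.pull k)

/-- The linear map `φ ↦ φ ∘ f` on `𝔪`. -/
noncomputable def pullMax (f : FormalMap n) :
    ↥((maxIdeal n).restrictScalars ℂ) →ₗ[ℂ] ↥((maxIdeal n).restrictScalars ℂ) :=
  f.pull.toLinearMap.restrict fun _ h => f.maxIdeal_le_comap h

/-- The action `[φ] ↦ [φ ∘ f]` of `f` on the space of `k`-jets. -/
noncomputable def jetMap (f : FormalMap n) (k : ℕ) : Module.End ℂ (JetSpace n k) :=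
  Submodule.mapQ _ _ f.pullMax fun _ h => f.maxIdeal_pow_le_comap (k + 1) h

theorem jetMap_mul (f g : FormalMap n) (k : ℕ) : (f * g).jetMap k = g.jetMap k * f.jetMap k := by
  ext φ
  change Submodule.Quotient.mk _ = Submodule.Quotient.mk _
  congr 1
  exact Subtype.ext (f.pull_mul g φ.1)

theorem jetMap_one (k : ℕ) : (1 : FormalMap n).jetMap k = 1 := by
  ext φ
  change Submodule.Quotient.mk _ = Submodule.Quotient.mk _
  congr 1
  exact Subtype.ext (pull_one φ.1)

end FormalMap

namespace FormalDiff

variable {n : ℕ}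

/-- The element `g_k` of `GL(𝔪 / 𝔪ᵏ⁺¹)` given by `[φ] ↦ [φ ∘ g]`. -/
noncomputable def jet (g : FormalDiff n) (k : ℕ) :
    LinearMap.GeneralLinearGroup ℂ (JetSpace n k) where
  val := g.1.jetMap k
  inv := (g⁻¹).1.jetMap k
  val_inv := by rw [← FormalMap.jetMap_mul, Units.inv_mul, FormalMap.jetMap_one]
  inv_val := by rw [← FormalMap.jetMap_mul, Units.mul_inv, FormalMap.jetMap_one]

end FormalDiff

/-- A subgroup of `GL(V)` is algebraic when it is the set of common zeros in `GL(V)` of a family of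
polynomial functions on `End(V)`, i.e. polynomials in the linear functionals on `End(V)`. -/
def IsAlgebraicSubgroup {V : Type*} [AddCommGroup V] [Module ℂ V]
    (H : Subgroup (LinearMap.GeneralLinearGroup ℂ V)) : Prop :=
  ∃ S : Set (MvPolynomial (Module.Dual ℂ (Module.End ℂ V)) ℂ),
    ∀ A : LinearMap.GeneralLinearGroup ℂ V,
      A ∈ H ↔ ∀ p ∈ S, MvPolynomial.eval (fun ℓ => ℓ (A : Module.End ℂ V)) p = 0

/-- The smallest algebraic subgroup of `GL(V)` containing a given set. -/
def algebraicHull {V : Type*} [AddCommGroup V] [Module ℂ V]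
    (C : Set (LinearMap.GeneralLinearGroup ℂ V)) : Subgroup (LinearMap.GeneralLinearGroup ℂ V) :=
  sInf {H | IsAlgebraicSubgroup H ∧ C ⊆ H}

/-- The algebraic closure of `G`: the set of all formal diffeomorphisms `h` such that, for every
`k`, `h_k` lies in the smallest algebraic subgroup of `GL(𝔪 / 𝔪ᵏ⁺¹)` containing
`{g_k : g ∈ G}`. -/
def algClosure {n : ℕ} (G : Subgroup (FormalDiff n)) : Set (FormalDiff n) :=
  {h | ∀ k : ℕ, h.jet k ∈ algebraicHull ((fun g : FormalDiff n => g.jet k) '' (G : Set _))}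

/-- The associate Lie algebra `log (G)` of `G`: the formal vector fields `X` such that `exp (t X)`
belongs to the algebraic closure of `G` for all `t ∈ ℂ`. -/
def logAlgebra {n : ℕ} (G : Subgroup (FormalDiff n)) : Set (FormalVectorField n) :=
  {X | ∀ t : ℂ, ∃ h ∈ algClosure G, X.IsExp t h}

/-! ### Formal meromorphic one-forms -/

/-- The partial derivative `∂T/∂zᵢ` of a formal meromorphic function, by the quotient rule. -/
noncomputable def pderivMero {n : ℕ} (i : Fin n) (T : FormalMero n) : FormalMero n :=
  let a : FormalSeries n := (IsLocalization.sec (nonZeroDivisors (FormalSeries n)) T).1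
  let b : FormalSeries n := (IsLocalization.sec (nonZeroDivisors (FormalSeries n)) T).2
  algebraMap (FormalSeries n) (FormalMero n) (pderiv ℂ i a * b - a * pderiv ℂ i b) /
    algebraMap (FormalSeries n) (FormalMero n) b ^ 2

/-- The partial derivative does not depend on the way `T` is written as a quotient. -/
theorem pderivMero_div {n : ℕ} (i : Fin n) (a b : FormalSeries n) (hb : b ≠ 0) :
    pderivMero i (algebraMap (FormalSeries n) (FormalMero n) a /
        algebraMap (FormalSeries n) (FormalMero n) b) =
      algebraMap (FormalSeries n) (FormalMero n) (pderiv ℂ i a * b - a * pderiv ℂ i b) /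
        algebraMap (FormalSeries n) (FormalMero n) b ^ 2 := by
  set T : FormalMero n := algebraMap (FormalSeries n) (FormalMero n) a /
    algebraMap (FormalSeries n) (FormalMero n) b with hT
  have hinj := IsFractionRing.injective (FormalSeries n) (FormalMero n)
  unfold pderivMero
  have hs := IsLocalization.sec_spec (nonZeroDivisors (FormalSeries n)) T
  set c := (IsLocalization.sec (nonZeroDivisors (FormalSeries n)) T).1
  set d' := (IsLocalization.sec (nonZeroDivisors (FormalSeries n)) T).2
  have hd : (d' : FormalSeries n) ≠ 0 := nonZeroDivisors.ne_zero d'.2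
  generalize (d' : FormalSeries n) = d at hs hd ⊢
  have hb' : algebraMap (FormalSeries n) (FormalMero n) b ≠ 0 := by
    simpa using (map_ne_zero_iff _ hinj).2 hb
  have hd' : algebraMap (FormalSeries n) (FormalMero n) d ≠ 0 := by
    simpa using (map_ne_zero_iff _ hinj).2 hd
  have h : a * d = c * b := by
    apply hinj
    rw [map_mul, map_mul, ← hs, hT]
    field_simp
  have h2 : pderiv ℂ i a * d + a * pderiv ℂ i d = pderiv ℂ i c * b + c * pderiv ℂ i b := by
    have := congrArg (pderiv ℂ i) h
    simp only [Derivation.leibniz, smul_eq_mul] at this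
    linear_combination this
  rw [div_eq_div_iff (pow_ne_zero 2 hd') (pow_ne_zero 2 hb')]
  simp only [← map_pow, ← map_mul]
  congr 1
  linear_combination (-(b * d)) * h2 + (b * pderiv ℂ i d + d * pderiv ℂ i b) * h

/-- The exact formal meromorphic one-form `dT = ∑ (∂T/∂zᵢ) dzᵢ`. Formal meromorphic one-forms
`∑ Rᵢ dzᵢ` are identified with the tuple of their coefficients `Rᵢ`. -/
noncomputable def exactForm {n : ℕ} (T : FormalMero n) : Fin n → FormalMero n :=
  fun i => pderivMero i T

/-- The pull-back `g^* ω = ∑ⱼ (Rⱼ ∘ g) dgⱼ` of the formal meromorphic one-form `ω = ∑ⱼ Rⱼ dzⱼ`. -/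
noncomputable def pullForm {n : ℕ} (g : FormalDiff n) (ω : Fin n → FormalMero n) :
    Fin n → FormalMero n :=
  fun i => ∑ j, g.pullMero (ω j) *
    algebraMap (FormalSeries n) (FormalMero n) (pderiv ℂ i (g.1.comp j))

/-- `G` leaves invariant the one-form `ω`: `g^* ω = ω` for all `g ∈ G`. -/
def IsInvariantForm {n : ℕ} (G : Subgroup (FormalDiff n)) (ω : Fin n → FormalMero n) : Prop :=
  ∀ g ∈ G, pullForm g ω = ω

/-- `G` embeds into the flow of `X`: every element of `G` is `exp (t X)` for some `t ∈ ℂ`. -/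
def EmbedsInFlow {n : ℕ} (G : Subgroup (FormalDiff n)) (X : FormalVectorField n) : Prop :=
  ∀ g ∈ G, ∃ t : ℂ, X.IsExp t g

/-! ### The filtration by powers of the maximal ideal -/

section MaxIdeal

variable {n : ℕ}

/-! Composition with a diffeomorphism `g` tangent to the identity is an operator `1 + N` on power
series, where `N` raises the order. Every power series in `N` therefore makes sense, in particular
the complex powers `(1 + N)ᵗ` (binomial series) and `log (1 + N)`. A given coefficient of `(1 + N)ᵗ
φ` is a polynomial in `t`, and at `t = k` it is the coefficient of `φ ∘ gᵏ`. A polynomial identity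
valid for the iterates thus holds for all complex `t`. In this way `(1 + N)ᵗ` is multiplicative, so
it is composition with a formal diffeomorphism `gᵗ`; its derivative at `t = 0` is a derivation, so
it is a vector field `log g`; and `gᵗ` satisfies every algebraic equation satisfied by the jets of
the iterates. Since `gᵗ = exp (t log g)`, the field `log g` lies in `logAlgebra G` (`flow_eq_exp`,
`flow_mem_algClosure`).

Whatever commutes with `g` commutes with series in `N`, so for abelian `G` the fields `log g` are
`G`-invariant and commute pairwise. If they all lie on one complex line, `G` embeds in a flow.
Otherwise two of them are independent over `ℂ`. Either they are also independent over the
meromorphic functions, or their ratio `T` is a nonconstant invariant function and `dT` is invariant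
(`exists_invariant_exactForm`). -/

theorem mem_maxIdeal {φ : FormalSeries n} : φ ∈ maxIdeal n ↔ constantCoeff φ = 0 := Iff.rfl

theorem coeff_eq_zero_of_mem_maxIdeal_pow {k : ℕ} {φ : FormalSeries n} (h : φ ∈ maxIdeal n ^ k)
    {d : Fin n →₀ ℕ} (hd : d.degree < k) : coeff d φ = 0 := by
  suffices (k : ℕ∞) ≤ φ.order from coeff_of_lt_order (lt_of_lt_of_le (by exact_mod_cast hd) this)
  clear hd
  induction k generalizing φ with
  | zero => simp
  | succ k ih =>
    rw [pow_succ] at h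
    refine Submodule.mul_induction_on h (fun a ha b hb => ?_) fun a b ha hb => ?_
    · refine le_trans ?_ le_order_mul
      push_cast
      exact add_le_add (ih ha) (one_le_order_iff_constCoeff_eq_zero.2 hb)
    · exact (le_min ha hb).trans min_order_le_add

/-- The part of `φ` made of the monomials whose first variable is `zᵢ`, divided by `zᵢ`. -/
noncomputable def divX (i : Fin n) (φ : FormalSeries n) : FormalSeries n :=
  fun d => if ∀ j < i, d j = 0 then coeff (d + Finsupp.single i 1) φ else 0

theorem coeff_divX (i : Fin n) (φ : FormalSeries n) (d : Fin n →₀ ℕ) :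
    coeff d (divX i φ) = if ∀ j < i, d j = 0 then coeff (d + Finsupp.single i 1) φ else 0 := rfl

/-- Each nonconstant monomial is picked up by exactly one summand, that of the least variable
occurring in it. -/
theorem sum_X_mul_divX {φ : FormalSeries n} (h : constantCoeff φ = 0) :
    ∑ i, X i * divX i φ = φ := by
  ext d
  rw [map_sum]
  by_cases hd : d = 0
  · subst hd
    rw [coeff_zero_eq_constantCoeff_apply, h]
    refine Finset.sum_eq_zero fun i _ => ?_
    simp
  · have hne : (d.support).Nonempty := Finsupp.support_nonempty_iff.2 hd
    set i := d.support.min' hne with hi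
    have hdi : d i ≠ 0 := Finsupp.mem_support_iff.1 (d.support.min'_mem hne)
    have hlt : ∀ j < i, d j = 0 := fun j hj => by
      by_contra hdj
      exact absurd (d.support.min'_le j (Finsupp.mem_support_iff.2 hdj)) (not_le.2 hj)
    have key : ∀ j, coeff d (X j * divX j φ) = if j = i then coeff d φ else 0 := by
      intro j
      rw [X, coeff_monomial_mul, one_mul]
      by_cases hj : d j = 0
      · rw [if_neg (by simpa [Finsupp.single_le_iff, Nat.one_le_iff_ne_zero] using hj), if_neg]
        rintro rfl
        exact hdi hj
      · have hle : Finsupp.single j 1 ≤ d := by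
          simpa [Finsupp.single_le_iff, Nat.one_le_iff_ne_zero] using hj
        rw [if_pos hle, coeff_divX, tsub_add_cancel_of_le hle]
        rcases lt_trichotomy j i with h1 | rfl | h1
        · exact absurd (hlt j h1) hj
        · rw [if_pos rfl, if_pos]
          intro l hl
          simp [hlt l hl]
        · rw [if_neg h1.ne', if_neg]
          intro hall
          have := hall i h1
          simp [h1.ne', hdi] at this
    simp [key]

/-- Splitting off one variable with `divX` lowers every degree by one, which drives the induction.
Ideal membership can then be checked on coefficients. -/
theorem mem_maxIdeal_pow_iff {k : ℕ} {φ : FormalSeries n} :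
    φ ∈ maxIdeal n ^ k ↔ ∀ d : Fin n →₀ ℕ, d.degree < k → coeff d φ = 0 := by
  refine ⟨fun h d hd => coeff_eq_zero_of_mem_maxIdeal_pow h hd, fun h => ?_⟩
  induction k generalizing φ with
  | zero => simp
  | succ k ih =>
    rw [← sum_X_mul_divX (h 0 (by simp))]
    refine Ideal.sum_mem _ fun i _ => ?_
    rw [pow_succ']
    refine Ideal.mul_mem_mul (constantCoeff_X i) (ih fun d hd => ?_)
    rw [coeff_divX]
    split_ifs
    · exact h _ (by simpa using hd)
    · rfl

theorem eq_zero_of_forall_mem_maxIdeal_pow {φ : FormalSeries n} (h : ∀ k, φ ∈ maxIdeal n ^ k) :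
    φ = 0 := by
  ext d
  exact coeff_eq_zero_of_mem_maxIdeal_pow (h (d.degree + 1)) (Nat.lt_succ_self _)

/-! ### Density of polynomials; rigidity of derivations and endomorphisms -/

/-- Density of polynomials in the `𝔪`-adic topology: a subspace `S` as in the hypotheses contains
all of them. It is applied to kernels. -/
theorem exists_X_mul_mem (φ : FormalSeries n) (k : ℕ) (S : Submodule ℂ (FormalSeries n))
    (h1 : ∀ c, (C c : FormalSeries n) ∈ S) (hX : ∀ i, ∀ ψ ∈ S, X i * ψ ∈ S) :
    ∃ ψ ∈ S, φ - ψ ∈ maxIdeal n ^ k := by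
  induction k generalizing φ with
  | zero => exact ⟨0, S.zero_mem, by simp⟩
  | succ k ih =>
    choose ψ hψ hd using fun i => ih (divX i (φ - C (constantCoeff φ)))
    refine ⟨C (constantCoeff φ) + ∑ i, X i * ψ i,
      S.add_mem (h1 _) (S.sum_mem fun i _ => hX i _ (hψ i)), ?_⟩
    rw [← sub_sub, ← sum_X_mul_divX (φ := φ - C (constantCoeff φ)) (by simp),
      ← Finset.sum_sub_distrib]
    refine Ideal.sum_mem _ fun i _ => ?_
    rw [← mul_sub, pow_succ']
    exact Ideal.mul_mem_mul (constantCoeff_X i) (hd i)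

/-- A derivation along an endomorphism is determined by its values on the coordinates. -/
theorem twisted_derivation_eq_zero (A : FormalSeries n →ₐ[ℂ] FormalSeries n)
    (hA : ∀ φ ∈ maxIdeal n, A φ ∈ maxIdeal n)
    (D : FormalSeries n →ₗ[ℂ] FormalSeries n)
    (hD : ∀ φ ψ, D (φ * ψ) = A φ * D ψ + D φ * A ψ) (hX : ∀ i, D (X i) = 0) : D = 0 := by
  have h1 : D 1 = 0 := by
    have := hD 1 1
    simp only [mul_one, map_one, one_mul] at this
    exact left_eq_add.1 this
  have hAk : ∀ k, ∀ φ ∈ maxIdeal n ^ k, A φ ∈ maxIdeal n ^ k := fun k φ hφ => by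
    have hle : maxIdeal n ≤ (maxIdeal n).comap A := hA
    exact ((Ideal.pow_right_mono hle k).trans (Ideal.le_comap_pow A k)) hφ
  -- By the Leibniz rule `D` loses at most one order, so it is continuous; the approximation below
  -- is therefore taken to order `k + 1`.
  have hDk : ∀ k, ∀ φ ∈ maxIdeal n ^ (k + 1), D φ ∈ maxIdeal n ^ k := by
    intro k
    induction k with
    | zero => simp
    | succ k ih =>
      intro φ hφ
      rw [pow_succ] at hφ
      refine Submodule.mul_induction_on hφ (fun a ha b hb => ?_) fun a b ha hb => ?_
      · rw [hD]
        refine Ideal.add_mem _ (Ideal.mul_mem_right _ _ (hAk _ _ ha)) ?_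
        rw [pow_succ]
        exact Ideal.mul_mem_mul (ih a ha) (hA b hb)
      · rw [map_add]
        exact Ideal.add_mem _ ha hb
  ext1 φ
  refine eq_zero_of_forall_mem_maxIdeal_pow fun k => ?_
  obtain ⟨ψ, hψ, hd⟩ := exists_X_mul_mem φ (k + 1) (LinearMap.ker D)
    (fun c => by
      rw [LinearMap.mem_ker, ← mul_one (C c), ← smul_eq_C_mul, map_smul, h1, smul_zero])
    (fun i ψ hψ => by
      rw [LinearMap.mem_ker] at hψ ⊢
      rw [hD, hψ, hX, mul_zero, zero_mul, add_zero])
  have := hDk k _ hd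
  rwa [map_sub, LinearMap.mem_ker.1 hψ, sub_zero] at this

/-- An endomorphism is determined by its values on the coordinates. -/
theorem algHom_eq_of_X (A B : FormalSeries n →ₐ[ℂ] FormalSeries n)
    (hA : ∀ φ ∈ maxIdeal n, A φ ∈ maxIdeal n) (hB : ∀ φ ∈ maxIdeal n, B φ ∈ maxIdeal n)
    (hX : ∀ i, A (X i) = B (X i)) : A = B := by
  have hk : ∀ (F : FormalSeries n →ₐ[ℂ] FormalSeries n) (_ : ∀ φ ∈ maxIdeal n, F φ ∈ maxIdeal n),
      ∀ k, ∀ φ ∈ maxIdeal n ^ k, F φ ∈ maxIdeal n ^ k := fun F hF k φ hφ => by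
    have hle : maxIdeal n ≤ (maxIdeal n).comap F := hF
    exact ((Ideal.pow_right_mono hle k).trans (Ideal.le_comap_pow F k)) hφ
  ext1 φ
  refine sub_eq_zero.1 (eq_zero_of_forall_mem_maxIdeal_pow fun k => ?_)
  obtain ⟨ψ, hψ, hd⟩ := exists_X_mul_mem φ k (LinearMap.ker (A.toLinearMap - B.toLinearMap))
    (fun c => by
      rw [LinearMap.mem_ker, ← mul_one (C c), ← smul_eq_C_mul, map_smul]
      simp)
    (fun i ψ hψ => by
      rw [LinearMap.mem_ker, LinearMap.sub_apply, AlgHom.toLinearMap_apply,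
        AlgHom.toLinearMap_apply, sub_eq_zero] at hψ ⊢
      rw [map_mul, map_mul, hψ, hX])
  rw [LinearMap.mem_ker, LinearMap.sub_apply, AlgHom.toLinearMap_apply,
    AlgHom.toLinearMap_apply, sub_eq_zero] at hψ
  have := Ideal.sub_mem _ (hk A hA k _ hd) (hk B hB k _ hd)
  rwa [map_sub, map_sub, hψ, sub_sub_sub_cancel_right] at this

theorem FormalMap.pull_X (f : FormalMap n) (i : Fin n) : f.pull (X i) = f.comp i := by
  rw [FormalMap.pull_eq, subst_X f.hasSubst]

/-- The chain rule. -/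
theorem pderiv_pull (f : FormalMap n) (i : Fin n) (φ : FormalSeries n) :
    pderiv ℂ i (f.pull φ) = ∑ j, f.pull (pderiv ℂ j φ) * pderiv ℂ i (f.comp j) := by
  -- The difference of the two sides is a derivation along `f.pull` that vanishes on coordinates.
  have := twisted_derivation_eq_zero f.pull (fun _ h => f.maxIdeal_le_comap h)
    ((pderiv ℂ i : FormalSeries n →ₗ[ℂ] FormalSeries n) ∘ₗ f.pull.toLinearMap -
      ∑ j, (LinearMap.mulRight ℂ (pderiv ℂ i (f.comp j))) ∘ₗ f.pull.toLinearMap ∘ₗ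
        (pderiv ℂ j : FormalSeries n →ₗ[ℂ] FormalSeries n))
    (fun φ ψ => by
      simp only [LinearMap.sub_apply, LinearMap.comp_apply, LinearMap.sum_apply,
        AlgHom.toLinearMap_apply, LinearMap.mulRight_apply, Derivation.coeFn_coe, map_mul,
        Derivation.leibniz, smul_eq_mul, map_add,
        Finset.sum_add_distrib, mul_sub, sub_mul, Finset.mul_sum, Finset.sum_mul]
      have e1 : ∀ a b c : FormalSeries n, a * b * c = a * (b * c) := fun a b c => mul_assoc _ _ _
      have e2 : ∀ x, f.pull ψ * f.pull (pderiv ℂ x φ) * pderiv ℂ i (f.comp x) =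
        f.pull (pderiv ℂ x φ) * pderiv ℂ i (f.comp x) * f.pull ψ := fun x => by ring
      simp only [e2]
      simp only [e1]
      ring)
    (fun l => by
      simp only [LinearMap.sub_apply, LinearMap.comp_apply, LinearMap.sum_apply,
        AlgHom.toLinearMap_apply, LinearMap.mulRight_apply, Derivation.coeFn_coe,
        FormalMap.pull_X, pderiv_X, Pi.single_apply]
      simp [apply_ite f.pull])
  have h := LinearMap.congr_fun this φ
  simpa [sub_eq_zero] using h

/-- A linear derivation of the ring of formal power series is given by its components. -/
theorem derivation_eq_apply (D : FormalSeries n →ₗ[ℂ] FormalSeries n)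
    (hD : ∀ φ ψ, D (φ * ψ) = φ * D ψ + D φ * ψ) (Y : FormalVectorField n)
    (hY : ∀ i, D (X i) = Y.1 i) (φ : FormalSeries n) : Y.apply φ = D φ := by
  have := twisted_derivation_eq_zero (AlgHom.id ℂ _) (fun _ h => h)
    (D - ∑ j, (LinearMap.mulLeft ℂ (Y.1 j)) ∘ₗ (pderiv ℂ j : FormalSeries n →ₗ[ℂ] FormalSeries n))
    (fun φ ψ => by
      simp only [LinearMap.sub_apply, LinearMap.comp_apply, LinearMap.sum_apply,
        AlgHom.id_apply, LinearMap.mulLeft_apply, Derivation.coeFn_coe, Derivation.leibniz,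
        smul_eq_mul, mul_add, hD,
        Finset.sum_add_distrib, mul_sub, sub_mul, Finset.mul_sum, Finset.sum_mul]
      have e1 : ∀ x, φ * (Y.1 x * pderiv ℂ x ψ) = Y.1 x * (φ * pderiv ℂ x ψ) := fun x => by ring
      have e2 : ∀ x, Y.1 x * pderiv ℂ x φ * ψ = Y.1 x * (ψ * pderiv ℂ x φ) := fun x => by ring
      simp only [e1, e2]
      ring)
    (fun l => by
      simp only [LinearMap.sub_apply, LinearMap.comp_apply, LinearMap.sum_apply,
        LinearMap.mulLeft_apply, Derivation.coeFn_coe, pderiv_X, Pi.single_apply, hY]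
      simp)
  have h := LinearMap.congr_fun this φ
  simp only [LinearMap.sub_apply, LinearMap.comp_apply, LinearMap.sum_apply,
        LinearMap.mulLeft_apply, Derivation.coeFn_coe, LinearMap.zero_apply, sub_eq_zero] at h
  exact h.symm

end MaxIdeal

/-! ### Functional calculus for operators raising the order -/

section Calculus

variable {n : ℕ}

/-- The operator `N` raises the order of formal power series. -/
def RaisesOrder (N : Module.End ℂ (FormalSeries n)) : Prop :=
  ∀ k, ∀ φ ∈ maxIdeal n ^ k, N φ ∈ maxIdeal n ^ (k + 1)

/-- The operator `B` does not lower the order of formal power series. -/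
def PreservesOrder (B : Module.End ℂ (FormalSeries n)) : Prop :=
  ∀ k, ∀ φ ∈ maxIdeal n ^ k, B φ ∈ maxIdeal n ^ k

theorem RaisesOrder.preservesOrder {N : Module.End ℂ (FormalSeries n)} (hN : RaisesOrder N) :
    PreservesOrder N :=
  fun k φ h => Ideal.pow_le_pow_right (Nat.le_succ k) (hN k φ h)

theorem RaisesOrder.pow_mem {N : Module.End ℂ (FormalSeries n)} (hN : RaisesOrder N) (j : ℕ)
    {k : ℕ} {φ : FormalSeries n} (h : φ ∈ maxIdeal n ^ k) : (N ^ j) φ ∈ maxIdeal n ^ (k + j) := by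
  induction j with
  | zero => simpa using h
  | succ j ih =>
    rw [pow_succ', Module.End.mul_apply, ← add_assoc]
    exact hN _ _ ih

theorem RaisesOrder.coeff_pow_eq_zero {N : Module.End ℂ (FormalSeries n)} (hN : RaisesOrder N)
    {j : ℕ} {d : Fin n →₀ ℕ} (hd : d.degree < j) (φ : FormalSeries n) :
    coeff d ((N ^ j) φ) = 0 :=
  coeff_eq_zero_of_mem_maxIdeal_pow (hN.pow_mem j (k := 0) (by simp)) (by simpa using hd)

/-- The operator `f(N) = ∑ⱼ fⱼ Nʲ`, where `f` is a power series in one variable and `N` raises the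
order. -/
noncomputable def opSeries (N : Module.End ℂ (FormalSeries n)) (f : PowerSeries ℂ) :
    Module.End ℂ (FormalSeries n) :=
  LinearMap.pi (R := ℂ) (φ := fun _ : Fin n →₀ ℕ => ℂ) fun d =>
    ∑ j ∈ Finset.range (d.degree + 1), PowerSeries.coeff j f • (coeff d ∘ₗ N ^ j)

theorem coeff_opSeries (N : Module.End ℂ (FormalSeries n)) (f : PowerSeries ℂ) (φ : FormalSeries n)
    (d : Fin n →₀ ℕ) : coeff d (opSeries N f φ) =
      ∑ j ∈ Finset.range (d.degree + 1), PowerSeries.coeff j f * coeff d ((N ^ j) φ) := by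
  change (∑ j ∈ Finset.range (d.degree + 1),
    PowerSeries.coeff j f • ((coeff d : FormalSeries n →ₗ[ℂ] ℂ) ∘ₗ N ^ j)) φ = _
  simp [LinearMap.sum_apply]

variable {N : Module.End ℂ (FormalSeries n)}

/-- Since `N ^ j` maps into `𝔪ʲ`, the truncation in `opSeries` discards only zero terms, and any
larger cutoff gives the same value. -/
theorem RaisesOrder.coeff_opSeries_of_le (hN : RaisesOrder N) (f : PowerSeries ℂ)
    (φ : FormalSeries n) {d : Fin n →₀ ℕ} {K : ℕ} (hd : d.degree ≤ K) :
    coeff d (opSeries N f φ) =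
      ∑ j ∈ Finset.range (K + 1), PowerSeries.coeff j f * coeff d ((N ^ j) φ) := by
  rw [coeff_opSeries]
  refine Finset.sum_subset (Finset.range_mono (by omega)) fun j _ hj => ?_
  rw [hN.coeff_pow_eq_zero (by simpa using hj), mul_zero]

theorem RaisesOrder.opSeries_sub_mem (hN : RaisesOrder N) (f : PowerSeries ℂ)
    (φ : FormalSeries n) (K : ℕ) :
    opSeries N f φ - ∑ j ∈ Finset.range (K + 1), PowerSeries.coeff j f • (N ^ j) φ ∈
      maxIdeal n ^ (K + 1) := by
  rw [mem_maxIdeal_pow_iff]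
  intro d hd
  rw [map_sub, hN.coeff_opSeries_of_le f φ (Nat.le_of_lt_succ hd), map_sum, sub_eq_zero]
  simp only [coeff_smul]

theorem RaisesOrder.preservesOrder_opSeries (hN : RaisesOrder N) (f : PowerSeries ℂ) :
    PreservesOrder (opSeries N f) := by
  intro k φ hφ
  rw [mem_maxIdeal_pow_iff]
  intro d hd
  rw [coeff_opSeries]
  refine Finset.sum_eq_zero fun j _ => ?_
  rw [coeff_eq_zero_of_mem_maxIdeal_pow (hN.pow_mem j hφ) (by omega), mul_zero]

theorem RaisesOrder.raisesOrder_opSeries (hN : RaisesOrder N) {f : PowerSeries ℂ}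
    (hf : PowerSeries.constantCoeff f = 0) : RaisesOrder (opSeries N f) := by
  intro k φ hφ
  rw [mem_maxIdeal_pow_iff]
  intro d hd
  rw [coeff_opSeries]
  refine Finset.sum_eq_zero fun j _ => ?_
  rcases j with _ | j
  · rw [PowerSeries.coeff_zero_eq_constantCoeff_apply, hf, zero_mul]
  · rw [coeff_eq_zero_of_mem_maxIdeal_pow (hN.pow_mem (j + 1) hφ) (by omega), mul_zero]

/-- As `B` preserves the order, the tail of the series stays negligible after applying `B`, and only
a polynomial in `N` has to be commuted. -/
theorem RaisesOrder.opSeries_comm (hN : RaisesOrder N) {B : Module.End ℂ (FormalSeries n)}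
    (hB : PreservesOrder B) (h : Commute B N) (f : PowerSeries ℂ) :
    Commute B (opSeries N f) := by
  ext φ d
  rw [Module.End.mul_apply, Module.End.mul_apply, coeff_opSeries]
  have h1 := coeff_eq_zero_of_mem_maxIdeal_pow (hB _ _ (hN.opSeries_sub_mem f φ d.degree))
    (Nat.lt_succ_self d.degree)
  rw [map_sub, map_sub, sub_eq_zero] at h1
  rw [h1, map_sum, map_sum]
  refine Finset.sum_congr rfl fun j _ => ?_
  rw [map_smul, coeff_smul, ← Module.End.mul_apply B, (h.pow_right j).eq, Module.End.mul_apply]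

theorem RaisesOrder.opSeries_mul (hN : RaisesOrder N) (f g : PowerSeries ℂ) :
    opSeries N (f * g) = opSeries N f * opSeries N g := by
  ext φ d
  have hc : ∀ i, (N ^ i) (opSeries N g φ) = opSeries N g ((N ^ i) φ) := fun i =>
    LinearMap.congr_fun
      (((hN.opSeries_comm hN.preservesOrder (Commute.refl N) g).pow_left i).eq) φ
  rw [Module.End.mul_apply, coeff_opSeries, coeff_opSeries]
  simp only [PowerSeries.coeff_mul, Finset.Nat.sum_antidiagonal_eq_sum_range_succ_mk, hc,
    coeff_opSeries, Finset.mul_sum, Finset.sum_mul]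
  have := Finset.sum_range_diag_flip (d.degree + 1) fun i j =>
    PowerSeries.coeff i f * (PowerSeries.coeff j g * coeff d ((N ^ j) ((N ^ i) φ)))
  refine Eq.trans ?_ (this.trans ?_)
  · refine Finset.sum_congr rfl fun m _ => Finset.sum_congr rfl fun i hi => ?_
    rw [← Module.End.mul_apply, ← pow_add, Nat.sub_add_cancel, mul_assoc]
    exact Nat.le_of_lt_succ (Finset.mem_range.1 hi)
  -- The triangle `i + j ≤ d.degree` is completed to the range of the inner series; the added terms
  -- contain `N ^ (i + j)` with `i + j > d.degree`.
  · refine Finset.sum_congr rfl fun i hi =>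
      Finset.sum_subset (Finset.range_mono (by omega)) fun j _ hj => ?_
    rw [← Module.End.mul_apply, ← pow_add, hN.coeff_pow_eq_zero, mul_zero, mul_zero]
    simp only [Finset.mem_range] at hi hj
    omega

theorem opSeries_one : opSeries N 1 = 1 := by
  ext φ d
  rw [coeff_opSeries, Finset.sum_eq_single_of_mem 0 (by simp)]
  · simp
  · intro j _ hj
    rw [PowerSeries.coeff_one, if_neg hj, zero_mul]

theorem RaisesOrder.opSeries_pow (hN : RaisesOrder N) (f : PowerSeries ℂ) (k : ℕ) :
    opSeries N (f ^ k) = opSeries N f ^ k := by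
  induction k with
  | zero => rw [pow_zero, pow_zero, opSeries_one]
  | succ k ih => rw [pow_succ, pow_succ, hN.opSeries_mul, ih]

theorem opSeries_one_add_X : opSeries N (1 + PowerSeries.X) = 1 + opSeries N PowerSeries.X := by
  ext φ d
  rw [LinearMap.add_apply, map_add, ← opSeries_one (N := N)]
  simp only [coeff_opSeries, map_add, add_mul, Finset.sum_add_distrib]

theorem RaisesOrder.opSeries_X (hN : RaisesOrder N) : opSeries N PowerSeries.X = N := by
  ext φ d
  -- The cutoff is raised by one so that the index `1` occurs even when `d = 0`.
  rw [hN.coeff_opSeries_of_le _ _ (Nat.le_succ d.degree),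
    Finset.sum_eq_single_of_mem 1 (by simp)]
  · simp
  · intro j _ hj
    rw [PowerSeries.coeff_X, if_neg hj, zero_mul]

end Calculus

/-! ### Binomial polynomials and the logarithmic series -/

section Binomial

open Polynomial hiding X C

/-- The polynomial `t ↦ t (t - 1) ⋯ (t - j + 1) / j!`. -/
noncomputable def choosePoly (j : ℕ) : ℂ[X] :=
  Polynomial.C ((j.factorial : ℂ)⁻¹) * descPochhammer ℂ j

theorem eval_choosePoly (t : ℂ) (j : ℕ) :
    (choosePoly j).eval t = PowerSeries.coeff j (PowerSeries.binomialSeries ℂ t) := by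
  rw [PowerSeries.binomialSeries_coeff, Ring.choose_eq_smul, choosePoly, eval_mul, eval_C,
    ← aeval_eq_smeval]
  rw [← descPochhammer_map (algebraMap ℤ ℂ), eval_map, ← aeval_def]
  simp

theorem choosePoly_eval_zero (j : ℕ) : (choosePoly j).eval 0 = if j = 0 then 1 else 0 := by
  rw [choosePoly, eval_mul, eval_C, descPochhammer_eval_zero]
  split_ifs with h <;> simp [h]

/-- The power series `∑ⱼ (d/dt)ₜ₌₀ (t choose j) zʲ = log (1 + z)`. -/
noncomputable def logSeries : PowerSeries ℂ :=
  PowerSeries.mk fun j => (derivative (choosePoly j)).eval 0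

theorem coeff_logSeries (j : ℕ) :
    PowerSeries.coeff j logSeries = (derivative (choosePoly j)).eval 0 :=
  PowerSeries.coeff_mk _ _

theorem constantCoeff_logSeries : PowerSeries.constantCoeff logSeries = 0 := by
  rw [← PowerSeries.coeff_zero_eq_constantCoeff_apply, coeff_logSeries]
  simp [choosePoly]

/-- Vandermonde's identity for `s + t choose j`, differentiated in `s` at `0`. In generating series:
`d/dt (1 + z)ᵗ = log (1 + z) · (1 + z)ᵗ`. -/
theorem derivative_choosePoly (j : ℕ) : derivative (choosePoly j) =
    ∑ p ∈ Finset.HasAntidiagonal.antidiagonal j,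
      Polynomial.C (PowerSeries.coeff p.1 logSeries) * choosePoly p.2 := by
  refine Polynomial.funext fun t => ?_
  have h : (choosePoly j).comp (Polynomial.X + Polynomial.C t) =
      ∑ p ∈ Finset.HasAntidiagonal.antidiagonal j,
        choosePoly p.1 * Polynomial.C ((choosePoly p.2).eval t) := by
    refine Polynomial.funext fun s => ?_
    simp only [eval_comp, eval_add, eval_X, eval_C, eval_finsetSum, eval_mul, eval_choosePoly,
      PowerSeries.binomialSeries_add, PowerSeries.coeff_mul]
  have h2 := congrArg (fun q => (derivative q).eval 0) h
  simpa [derivative_comp, derivative_sum, eval_finsetSum, coeff_logSeries] using h2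

theorem iterate_derivative_choosePoly (k j : ℕ) : derivative^[k] (choosePoly j) =
    ∑ p ∈ Finset.HasAntidiagonal.antidiagonal j,
      Polynomial.C (PowerSeries.coeff p.1 (logSeries ^ k)) * choosePoly p.2 := by
  induction k generalizing j with
  | zero =>
    rw [Finset.sum_eq_single_of_mem (0, j) (by simp)]
    · simp
    · rintro ⟨a, b⟩ h hne
      have : a ≠ 0 := by
        rintro rfl
        exact hne (by simpa using h)
      simp [PowerSeries.coeff_one, this]
  | succ k ih =>
    rw [Function.iterate_succ_apply, derivative_choosePoly, iterate_derivative_sum]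
    simp only [iterate_derivative_C_mul, ih, pow_succ', PowerSeries.coeff_mul, map_sum,
      Finset.sum_mul, Finset.mul_sum, map_mul]
    rw [Finset.sum_sigma', Finset.sum_sigma']
    refine (Finset.sum_nbij' (fun x => ⟨(x.1.1 + x.2.1, x.2.2), (x.1.1, x.2.1)⟩)
      (fun x => ⟨(x.2.1, x.2.2 + x.1.2), (x.2.2, x.1.2)⟩) ?_ ?_ ?_ ?_ ?_) <;>
      simp only [Finset.mem_sigma, Sigma.forall, Prod.forall] <;>
      intros <;> simp_all <;> first | omega | ring

/-- Taylor's formula at `t = 0`; this is `(1 + z)ᵗ = exp (t log (1 + z))` read off coefficient by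
coefficient. -/
theorem coeff_choosePoly (k j : ℕ) : (choosePoly j).coeff k =
    (k.factorial : ℂ)⁻¹ * PowerSeries.coeff j (logSeries ^ k) := by
  have h := congrArg (Polynomial.eval 0) (iterate_derivative_choosePoly k j)
  rw [← coeff_zero_eq_eval_zero, coeff_iterate_derivative, eval_finsetSum,
    Finset.sum_eq_single_of_mem (j, 0) (by simp)] at h
  · simp only [zero_add, Nat.descFactorial_self, eval_mul, eval_C, choosePoly_eval_zero, if_true,
      mul_one, nsmul_eq_mul] at h
    rw [← h, inv_mul_cancel_left₀ (by exact_mod_cast k.factorial_ne_zero)]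
  · rintro ⟨a, b⟩ h hne
    have : b ≠ 0 := by
      rintro rfl
      exact hne (by simpa using h)
    simp [choosePoly_eval_zero, this]

theorem natDegree_choosePoly_le (j : ℕ) : (choosePoly j).natDegree ≤ j :=
  (natDegree_C_mul_le _ _).trans (descPochhammer_natDegree ℂ j).le

end Binomial

/-! ### The one-parameter group of a formal diffeomorphism tangent to the identity -/

section Flow

open Polynomial hiding X C

variable {n : ℕ}

/-- The principle that carries identities from the iterates of `g` to all complex times. -/
theorem eq_of_eval_natCast {p q : ℂ[X]} (h : ∀ k : ℕ, p.eval (k : ℂ) = q.eval (k : ℂ)) : p = q :=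
  eq_of_infinite_eval_eq p q <| (Set.infinite_range_of_injective
    (Nat.cast_injective (R := ℂ))).mono <| by rintro _ ⟨k, rfl⟩; exact h k

namespace FormalDiff

/-- The operator `φ ↦ φ ∘ g - φ`. -/
noncomputable def diffOp (g : FormalDiff n) : Module.End ℂ (FormalSeries n) :=
  g.1.pull.toLinearMap - 1

theorem diffOp_apply (g : FormalDiff n) (φ : FormalSeries n) : g.diffOp φ = g.1.pull φ - φ := rfl

theorem diffOp_mul (g : FormalDiff n) (φ ψ : FormalSeries n) :
    g.diffOp (φ * ψ) = g.diffOp φ * g.1.pull ψ + φ * g.diffOp ψ := by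
  simp only [diffOp_apply, map_mul]
  ring

theorem preservesOrder_pull (g : FormalDiff n) : PreservesOrder g.1.pull.toLinearMap :=
  fun k _ h => g.1.maxIdeal_pow_le_comap k h

/-- Tangency puts `zᵢ ∘ g - zᵢ` in `𝔪²`. Division by the coordinates extends this to `𝔪`, and the
twisted Leibniz rule to all powers of `𝔪`. -/
theorem TangentToId.raisesOrder {g : FormalDiff n} (hg : g.TangentToId) :
    RaisesOrder g.diffOp := by
  have hX : ∀ i, g.diffOp (X i) ∈ maxIdeal n ^ 2 := fun i => by
    rw [mem_maxIdeal_pow_iff, diffOp_apply, FormalMap.pull_X]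
    intro d hd
    rcases Nat.lt_succ_iff_lt_or_eq.1 hd with h | h
    · obtain rfl : d = 0 := (Finsupp.degree_eq_zero_iff d).1 (by omega)
      simp [g.1.constantCoeff_comp i]
    · obtain ⟨j, rfl⟩ := (Finsupp.sum_eq_one_iff d).1 h
      rw [map_sub, hg i j, MvPowerSeries.coeff_X, Matrix.one_apply, sub_eq_zero]
      simp [Finsupp.single_left_inj, eq_comm]
  have h0 : ∀ φ, g.diffOp φ ∈ maxIdeal n := fun φ => by
    have h1 : g.diffOp φ = g.diffOp (φ - C (constantCoeff φ)) := by
      have : g.1.pull (C (constantCoeff φ)) = C (constantCoeff φ) :=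
        g.1.pull.commutes (constantCoeff φ)
      rw [map_sub, diffOp_apply g (C _), this, sub_self, sub_zero]
    have h2 : φ - C (constantCoeff φ) ∈ maxIdeal n := by simp [mem_maxIdeal]
    rw [h1, diffOp_apply]
    exact Ideal.sub_mem _ (g.1.maxIdeal_le_comap h2) h2
  have h1 : ∀ φ ∈ maxIdeal n, g.diffOp φ ∈ maxIdeal n ^ 2 := fun φ hφ => by
    rw [← sum_X_mul_divX hφ, map_sum]
    refine Ideal.sum_mem _ fun i _ => ?_
    rw [diffOp_mul]
    refine Ideal.add_mem _ (Ideal.mul_mem_right _ _ (hX i)) ?_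
    rw [pow_two]
    exact Ideal.mul_mem_mul (constantCoeff_X i) (h0 _)
  intro k
  induction k with
  | zero => intro φ _; simpa using h0 φ
  | succ k ih =>
    intro φ hφ
    rw [pow_succ] at hφ
    refine Submodule.mul_induction_on hφ (fun a ha b hb => ?_) fun a b ha hb => ?_
    · rw [diffOp_mul]
      refine Ideal.add_mem _ ?_ ?_
      · rw [pow_succ]
        exact Ideal.mul_mem_mul (ih a ha) (g.1.maxIdeal_le_comap hb)
      · rw [add_assoc, pow_add]
        exact Ideal.mul_mem_mul ha (h1 b hb)
    · rw [map_add]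
      exact Ideal.add_mem _ ha hb

/-- The operator `(φ ↦ φ ∘ g)ᵗ`. -/
noncomputable def flowOp (g : FormalDiff n) (t : ℂ) : Module.End ℂ (FormalSeries n) :=
  opSeries g.diffOp (PowerSeries.binomialSeries ℂ t)

/-- The operator `log (φ ↦ φ ∘ g)`. -/
noncomputable def logOp (g : FormalDiff n) : Module.End ℂ (FormalSeries n) :=
  opSeries g.diffOp logSeries

variable {g : FormalDiff n}

theorem TangentToId.flowOp_natCast (hg : g.TangentToId) (k : ℕ) :
    g.flowOp k = g.1.pull.toLinearMap ^ k := by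
  rw [flowOp, PowerSeries.binomialSeries_nat, hg.raisesOrder.opSeries_pow, opSeries_one_add_X,
    hg.raisesOrder.opSeries_X, diffOp, add_sub_cancel]

theorem TangentToId.flowOp_add (hg : g.TangentToId) (s t : ℂ) :
    g.flowOp (s + t) = g.flowOp s * g.flowOp t := by
  rw [flowOp, PowerSeries.binomialSeries_add, hg.raisesOrder.opSeries_mul, flowOp, flowOp]

theorem flowOp_zero : g.flowOp 0 = 1 := by
  rw [flowOp, PowerSeries.binomialSeries_zero, opSeries_one]

/-- The coefficients of `(φ ↦ φ ∘ g)ᵗ φ` are polynomials in `t`. -/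
noncomputable def flowPoly (g : FormalDiff n) (φ : FormalSeries n) (d : Fin n →₀ ℕ) : ℂ[X] :=
  ∑ j ∈ Finset.range (d.degree + 1), choosePoly j * Polynomial.C (coeff d ((g.diffOp ^ j) φ))

theorem eval_flowPoly (φ : FormalSeries n) (d : Fin n →₀ ℕ) (t : ℂ) :
    (g.flowPoly φ d).eval t = coeff d (g.flowOp t φ) := by
  simp only [flowPoly, flowOp, coeff_opSeries, eval_finsetSum, eval_mul, eval_C, eval_choosePoly]

theorem derivative_flowPoly (φ : FormalSeries n) (d : Fin n →₀ ℕ) :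
    (derivative (g.flowPoly φ d)).eval 0 = coeff d (g.logOp φ) := by
  simp only [flowPoly, logOp, coeff_opSeries, coeff_logSeries, derivative_sum, eval_finsetSum,
    derivative_mul, derivative_C, mul_zero, add_zero, eval_mul, eval_C]

theorem pull_pow_mul (g : FormalDiff n) (k : ℕ) (φ ψ : FormalSeries n) :
    (g.1.pull.toLinearMap ^ k) (φ * ψ) =
      (g.1.pull.toLinearMap ^ k) φ * (g.1.pull.toLinearMap ^ k) ψ := by
  induction k with
  | zero => rfl
  | succ k ih => simp only [pow_succ', Module.End.mul_apply, ih, AlgHom.toLinearMap_apply, map_mul]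

/-- Both sides are polynomials in `t`, and at `t = k` the identity says that composition with `gᵏ`
is multiplicative. Evaluating at `t` gives `flowOp_mul`; differentiating at `0` gives the Leibniz
rule `logOp_mul`. -/
theorem TangentToId.flowPoly_mul (hg : g.TangentToId) (φ ψ : FormalSeries n) (d : Fin n →₀ ℕ) :
    g.flowPoly (φ * ψ) d =
      ∑ p ∈ Finset.HasAntidiagonal.antidiagonal d, g.flowPoly φ p.1 * g.flowPoly ψ p.2 := by
  refine eq_of_eval_natCast fun k => ?_
  simp only [eval_finsetSum, eval_mul, eval_flowPoly, hg.flowOp_natCast, pull_pow_mul,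
    MvPowerSeries.coeff_mul]

theorem TangentToId.flowOp_mul (hg : g.TangentToId) (t : ℂ) (φ ψ : FormalSeries n) :
    g.flowOp t (φ * ψ) = g.flowOp t φ * g.flowOp t ψ := by
  ext d
  rw [← eval_flowPoly, hg.flowPoly_mul, MvPowerSeries.coeff_mul]
  simp only [eval_finsetSum, eval_mul, eval_flowPoly]

theorem TangentToId.logOp_mul (hg : g.TangentToId) (φ ψ : FormalSeries n) :
    g.logOp (φ * ψ) = φ * g.logOp ψ + g.logOp φ * ψ := by
  ext d
  rw [← derivative_flowPoly, hg.flowPoly_mul, map_add, MvPowerSeries.coeff_mul, MvPowerSeries.coeff_mul,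
    derivative_sum,
    eval_finsetSum, ← Finset.sum_add_distrib]
  refine Finset.sum_congr rfl fun p _ => ?_
  rw [derivative_mul, eval_add, eval_mul, eval_mul, eval_flowPoly, eval_flowPoly,
    derivative_flowPoly, derivative_flowPoly, flowOp_zero, Module.End.one_apply,
    Module.End.one_apply, add_comm]

theorem TangentToId.flowOp_one (hg : g.TangentToId) (t : ℂ) : g.flowOp t 1 = 1 := by
  ext d
  rw [← eval_flowPoly]
  have : g.flowPoly 1 d = Polynomial.C (MvPowerSeries.coeff d 1) := eq_of_eval_natCast fun k => by
    rw [eval_flowPoly, hg.flowOp_natCast, eval_C]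
    congr 1
    induction k with
    | zero => rfl
    | succ k ih => rw [pow_succ', Module.End.mul_apply, ih, AlgHom.toLinearMap_apply, map_one]
  rw [this, eval_C]

theorem TangentToId.flowOp_mem_maxIdeal (hg : g.TangentToId) (t : ℂ) {φ : FormalSeries n}
    (h : φ ∈ maxIdeal n) : g.flowOp t φ ∈ maxIdeal n := by
  have := hg.raisesOrder.preservesOrder_opSeries (PowerSeries.binomialSeries ℂ t) 1 φ
    (by simpa using h)
  rwa [pow_one] at this

theorem TangentToId.raisesOrder_logOp (hg : g.TangentToId) : RaisesOrder g.logOp :=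
  hg.raisesOrder.raisesOrder_opSeries constantCoeff_logSeries

/-- The formal map `gᵗ`. -/
noncomputable def TangentToId.flowMap (hg : g.TangentToId) (t : ℂ) : FormalMap n :=
  ⟨fun i => g.flowOp t (X i), fun i => hg.flowOp_mem_maxIdeal t (constantCoeff_X i)⟩

theorem TangentToId.pull_flowMap (hg : g.TangentToId) (t : ℂ) (φ : FormalSeries n) :
    (hg.flowMap t).pull φ = g.flowOp t φ := by
  have := algHom_eq_of_X (hg.flowMap t).pull
    (AlgHom.ofLinearMap (g.flowOp t) (hg.flowOp_one t) (hg.flowOp_mul t))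
    (fun _ h => (hg.flowMap t).maxIdeal_le_comap h) (fun _ h => hg.flowOp_mem_maxIdeal t h)
    (fun i => by rw [FormalMap.pull_X]; rfl)
  exact DFunLike.congr_fun this φ

theorem TangentToId.flowMap_mul (hg : g.TangentToId) (s t : ℂ) :
    hg.flowMap s * hg.flowMap t = hg.flowMap (s + t) := by
  ext1
  funext i
  rw [FormalMap.mul_comp, hg.pull_flowMap]
  change g.flowOp t (g.flowOp s (X i)) = g.flowOp (s + t) (X i)
  -- Pull-back reverses composition, hence the exchange of `s` and `t`.
  rw [add_comm, hg.flowOp_add, Module.End.mul_apply]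

theorem TangentToId.flowMap_zero (hg : g.TangentToId) : hg.flowMap 0 = 1 := by
  ext1
  funext i
  change g.flowOp 0 (X i) = _
  rw [flowOp_zero]
  rfl

/-- The formal diffeomorphism `gᵗ`. -/
noncomputable def TangentToId.flow (hg : g.TangentToId) (t : ℂ) : FormalDiff n where
  val := hg.flowMap t
  inv := hg.flowMap (-t)
  val_inv := by rw [hg.flowMap_mul, add_neg_cancel, hg.flowMap_zero]
  inv_val := by rw [hg.flowMap_mul, neg_add_cancel, hg.flowMap_zero]

theorem TangentToId.flow_natCast (hg : g.TangentToId) (k : ℕ) : hg.flow k = g ^ k := by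
  induction k with
  | zero =>
    refine Units.ext ?_
    rw [pow_zero, Nat.cast_zero]
    exact hg.flowMap_zero
  | succ k ih =>
    rw [pow_succ, ← ih]
    refine Units.ext ?_
    change hg.flowMap _ = hg.flowMap _ * g.1
    push_cast
    rw [← hg.flowMap_mul]
    congr 1
    ext1
    funext i
    change g.flowOp 1 (X i) = _
    rw [← Nat.cast_one, hg.flowOp_natCast, pow_one, AlgHom.toLinearMap_apply, FormalMap.pull_X]

/-- The infinitesimal generator of `g`. -/
noncomputable def TangentToId.log (hg : g.TangentToId) : FormalVectorField n :=
  ⟨fun i => g.logOp (X i), fun i => by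
    have := hg.raisesOrder_logOp.preservesOrder 1 (X i) (by simp [mem_maxIdeal])
    simpa [mem_maxIdeal] using this⟩

theorem TangentToId.log_apply (hg : g.TangentToId) (φ : FormalSeries n) :
    hg.log.apply φ = g.logOp φ :=
  derivation_eq_apply g.logOp hg.logOp_mul hg.log (fun _ => rfl) φ

/-- The exponential series has finitely many nonzero terms in each coefficient because `logOp`
raises the order. Expanding both sides in powers of `diffOp` reduces the claim to
`coeff_choosePoly`. -/
theorem TangentToId.flow_eq_exp (hg : g.TangentToId) (t : ℂ) : hg.log.IsExp t (hg.flow t) := by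
  intro i d
  have hL : ∀ j φ, hg.log.apply^[j] φ = (g.logOp ^ j) φ := fun j φ => by
    rw [Module.End.pow_apply]
    exact congrArg (fun F : FormalSeries n → FormalSeries n => F^[j] φ) (funext hg.log_apply)
  have hfin : ∀ j ∉ Finset.range (d.degree + 1),
      t ^ j / (j.factorial : ℂ) * coeff d (hg.log.apply^[j] (X i)) = 0 := fun j hj => by
    rw [hL, hg.raisesOrder_logOp.coeff_pow_eq_zero (by simpa using hj), mul_zero]
  suffices h : coeff d (g.flowOp t (X i)) = ∑ j ∈ Finset.range (d.degree + 1),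
      t ^ j / (j.factorial : ℂ) * coeff d (hg.log.apply^[j] (X i)) from
    h ▸ hasSum_sum_of_ne_finset_zero hfin
  simp only [hL, ← eval_flowPoly, flowPoly, eval_finsetSum, eval_mul, eval_C, logOp,
    ← hg.raisesOrder.opSeries_pow, coeff_opSeries, Finset.mul_sum]
  rw [Finset.sum_comm]
  refine Finset.sum_congr rfl fun j hj => ?_
  rw [eval_eq_sum_range' (n := d.degree + 1)
    (lt_of_le_of_lt (natDegree_choosePoly_le j) (Finset.mem_range.1 hj)), Finset.sum_mul]
  refine Finset.sum_congr rfl fun k _ => ?_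
  rw [coeff_choosePoly]
  ring

theorem TangentToId.log_isExp_one (hg : g.TangentToId) : hg.log.IsExp 1 g := by
  have := hg.flow_eq_exp 1
  rwa [← Nat.cast_one, hg.flow_natCast, pow_one, Nat.cast_one] at this

/-! ### The flow lies in the algebraic closure -/

/-- Modulo `𝔪ᵏ⁺¹` the binomial series stops at `j = k`, so the jet of `gᵗ` is polynomial in `t`. -/
theorem TangentToId.jet_flow (hg : g.TangentToId) (t : ℂ) (k : ℕ) :
    ((hg.flow t).jet k : Module.End ℂ (JetSpace n k)) =
      ∑ j ∈ Finset.range (k + 1), (choosePoly j).eval t • (g.1.jetMap k - 1) ^ j := by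
  have hq : ∀ (j : ℕ) (φ : ↥((maxIdeal n).restrictScalars ℂ)),
      ((g.1.pullMax - 1) ^ j : Module.End ℂ ↥((maxIdeal n).restrictScalars ℂ)) φ =
        (g.diffOp ^ j) φ.1 := fun j φ => by
    induction j with
    | zero => rfl
    | succ j ih =>
      rw [pow_succ', pow_succ', Module.End.mul_apply, Module.End.mul_apply, ← ih]
      rfl
  have hp : ∀ (j : ℕ) (φ : ↥((maxIdeal n).restrictScalars ℂ)),
      ((g.1.jetMap k - 1) ^ j : Module.End ℂ (JetSpace n k)) (Submodule.Quotient.mk φ) =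
        Submodule.Quotient.mk (((g.1.pullMax - 1) ^ j :
          Module.End ℂ ↥((maxIdeal n).restrictScalars ℂ)) φ) := fun j φ => by
    induction j with
    | zero => rfl
    | succ j ih =>
      rw [pow_succ' (_ - _ : Module.End ℂ (JetSpace n k)),
        pow_succ' (_ - _ : Module.End ℂ ↥((maxIdeal n).restrictScalars ℂ)),
        Module.End.mul_apply, Module.End.mul_apply, ih]
      rfl
  refine LinearMap.ext fun v => ?_
  obtain ⟨φ, rfl⟩ := Submodule.Quotient.mk_surjective _ v
  simp only [LinearMap.sum_apply, LinearMap.smul_apply, hp]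
  change Submodule.Quotient.mk ((hg.flowMap t).pullMax φ) = _
  have hs : ∀ (c : ℕ → ℂ) (v : ℕ → ↥((maxIdeal n).restrictScalars ℂ)),
      ∑ j ∈ Finset.range (k + 1), c j • (Submodule.Quotient.mk (v j) : JetSpace n k) =
        Submodule.Quotient.mk (∑ j ∈ Finset.range (k + 1), c j • v j) := fun c v => by
    rw [← Submodule.mkQ_apply, map_sum]
    rfl
  rw [hs, Submodule.Quotient.eq]
  change (((hg.flowMap t).pullMax φ - ∑ j ∈ Finset.range (k + 1), _ :
    ↥((maxIdeal n).restrictScalars ℂ)) : FormalSeries n) ∈ maxIdeal n ^ (k + 1)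
  rw [Submodule.coe_sub, Submodule.coe_sum]
  simp only [Submodule.coe_smul, hq]
  have := hg.raisesOrder.opSeries_sub_mem (PowerSeries.binomialSeries ℂ t) φ.1 k
  simp only [← eval_choosePoly] at this
  convert this using 1
  congr 1
  exact hg.pull_flowMap t φ.1

theorem TangentToId.flow_mem_algClosure (hg : g.TangentToId) {G : Subgroup (FormalDiff n)}
    (hgG : g ∈ G) (t : ℂ) : hg.flow t ∈ algClosure G := by
  intro k
  rw [algebraicHull, Subgroup.mem_sInf]
  rintro H ⟨⟨S, hS⟩, hsub⟩
  refine (hS _).2 fun p hp => ?_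
  -- `Q ℓ` is the polynomial `s ↦ ℓ` (jet of `gˢ`). Substituting it into `p` gives a polynomial in
  -- `s` vanishing at every natural number, since `gᵐ ∈ G`.
  let Q : Module.Dual ℂ (Module.End ℂ (JetSpace n k)) → ℂ[X] := fun ℓ =>
    ∑ j ∈ Finset.range (k + 1), choosePoly j * Polynomial.C (ℓ ((g.1.jetMap k - 1) ^ j))
  have hQ : ∀ s : ℂ, (MvPolynomial.aeval Q p).eval s =
      MvPolynomial.eval (fun ℓ => ℓ ((hg.flow s).jet k : Module.End ℂ (JetSpace n k))) p := by
    intro s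
    rw [← Polynomial.coe_evalRingHom, MvPolynomial.aeval_def, MvPolynomial.hom_eval₂,
      MvPolynomial.eval, MvPolynomial.coe_eval₂Hom]
    congr 1
    · ext1 c
      simp
    · funext ℓ
      simp only [Polynomial.coe_evalRingHom, Q, eval_mul, eval_C,
        hg.jet_flow, map_sum, map_smul, smul_eq_mul]
  rw [← hQ]
  have h0 : MvPolynomial.aeval Q p = 0 := eq_of_eval_natCast fun m => by
    rw [hQ, eval_zero, hg.flow_natCast]
    exact (hS _).1 (hsub ⟨g ^ m, G.pow_mem hgG m, rfl⟩) p hp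
  rw [h0, eval_zero]

theorem TangentToId.log_mem_logAlgebra (hg : g.TangentToId) {G : Subgroup (FormalDiff n)}
    (hgG : g ∈ G) : hg.log ∈ logAlgebra G :=
  fun t => ⟨hg.flow t, hg.flow_mem_algClosure hgG t, hg.flow_eq_exp t⟩

/-! ### Logarithms of commuting diffeomorphisms -/

theorem TangentToId.logOp_pull_comm (hg : g.TangentToId) {h : FormalDiff n} (hc : g * h = h * g) :
    Commute h.1.pull.toLinearMap g.logOp := by
  refine hg.raisesOrder.opSeries_comm h.preservesOrder_pull ?_ _
  refine LinearMap.ext fun φ => ?_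
  have : g.1 * h.1 = h.1 * g.1 := congrArg Units.val hc
  simp only [Module.End.mul_apply, AlgHom.toLinearMap_apply, diffOp_apply, map_sub,
    ← FormalMap.pull_mul, this]

theorem TangentToId.logOp_comm (hg : g.TangentToId) {h : FormalDiff n} (hh : h.TangentToId)
    (hc : g * h = h * g) : Commute g.logOp h.logOp :=
  hh.raisesOrder.opSeries_comm hg.raisesOrder_logOp.preservesOrder
    ((hg.logOp_pull_comm hc).symm.sub_right (Commute.one_right _)) _

theorem TangentToId.log_isInvariant (hg : g.TangentToId) {G : Subgroup (FormalDiff n)}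
    (hG : ∀ h ∈ G, g * h = h * g) : hg.log.IsInvariant G := by
  intro h hh
  funext i
  rw [FormalVectorField.pushforward, hg.log_apply, ← FormalMap.pull_X]
  have := LinearMap.congr_fun (hg.logOp_pull_comm (hG h hh)).eq (X i)
  simp only [Module.End.mul_apply, AlgHom.toLinearMap_apply] at this
  rw [← this, ← FormalMap.pull_mul, Units.mul_inv, FormalMap.pull_one]
  rfl

theorem TangentToId.bracket_log (hg : g.TangentToId) {h : FormalDiff n} (hh : h.TangentToId)
    (hc : g * h = h * g) : hg.log.bracket hh.log = 0 := by
  funext i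
  rw [FormalVectorField.bracket, hg.log_apply, hh.log_apply]
  exact sub_eq_zero.2 (LinearMap.congr_fun (hg.logOp_comm hh hc).eq (X i))

end FormalDiff

end Flow

/-! ### Formal meromorphic functions -/

section Mero

variable {n : ℕ}

/-- A quotient of power series all of whose partial derivatives vanish is constant. -/
theorem eq_C_mul_of_pderiv {a b : FormalSeries n} (hb : b ≠ 0)
    (h : ∀ i, pderiv ℂ i a * b = a * pderiv ℂ i b) : ∃ c : ℂ, a = C c * b := by
  -- Lexicographic leading terms are compared. The constant `c` is chosen so that `a' = a - c b` has
  -- no term at the leading exponent `q` of `b`.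
  obtain ⟨q, hq⟩ := exists_finsupp_eq_lexOrder_of_ne_zero hb
  have hbq : coeff q b ≠ 0 := coeff_ne_zero_of_lexOrder hq.symm
  refine ⟨coeff q a / coeff q b, ?_⟩
  set c := coeff q a / coeff q b with hc
  by_contra hne
  set a' := a - C c * b with ha'
  have ha0 : a' ≠ 0 := sub_ne_zero.2 hne
  have hq0 : coeff q a' = 0 := by
    rw [ha', map_sub, coeff_C_mul, hc, div_mul_cancel₀ _ hbq, sub_self]
  obtain ⟨p, hp⟩ := exists_finsupp_eq_lexOrder_of_ne_zero ha0
  have hap : coeff p a' ≠ 0 := coeff_ne_zero_of_lexOrder hp.symm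
  have h' : ∀ i, X i * pderiv ℂ i a' * b = a' * (X i * pderiv ℂ i b) := fun i => by
    rw [ha', map_sub, Derivation.leibniz, pderiv_C]
    simp only [smul_eq_mul, mul_zero, add_zero]
    linear_combination (X i) * h i
  -- The Euler operators `zᵢ ∂/∂zᵢ` multiply each coefficient by its exponent, so they create no
  -- earlier terms. The coefficient at `p + q` of `h' i` then gives `p i = q i`, whence `p = q`,
  -- against the choice of `c`.
  have hθ : ∀ (i : Fin n) (φ : FormalSeries n) (d : Fin n →₀ ℕ),
      coeff d (X i * pderiv ℂ i φ) = d i * coeff d φ := fun i φ d => by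
    rw [X, coeff_monomial_mul, one_mul]
    split_ifs with hd
    · rw [coeff_pderiv, tsub_add_cancel_of_le hd]
      have h1 : 1 ≤ d i := by simpa using hd
      have h2 : (((d - Finsupp.single i 1 : Fin n →₀ ℕ) i : ℕ) : ℂ) + 1 = d i := by
        rw [Finsupp.tsub_apply, Finsupp.single_eq_same]
        exact_mod_cast Nat.sub_add_cancel h1
      rw [h2, mul_comm]
    · have h1 : d i = 0 := by
        by_contra h0
        exact hd (by simpa using Nat.one_le_iff_ne_zero.2 h0)
      rw [h1, Nat.cast_zero, zero_mul]
  have key : ∀ (φ ψ : FormalSeries n), (∀ d, toLex d < toLex p → coeff d φ = 0) →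
      (∀ d, toLex d < toLex q → coeff d ψ = 0) →
      coeff (p + q) (φ * ψ) = coeff p φ * coeff q ψ := by
    intro φ ψ hφ hψ
    rw [coeff_mul, Finset.sum_eq_single_of_mem ⟨p, q⟩ (by simp)]
    rintro ⟨u, v⟩ huv hne
    rw [Finset.HasAntidiagonal.mem_antidiagonal] at huv
    rcases trichotomy_of_add_eq_add (congrArg toLex huv) with h3 | h3 | h3
    · exact absurd (Prod.ext h3.1 h3.2) hne
    · rw [hφ u h3, zero_mul]
    · rw [hψ v h3, mul_zero]
  have hpa : ∀ d, toLex d < toLex p → coeff d a' = 0 := fun d hd =>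
    coeff_eq_zero_of_lt_lexOrder (by rw [hp]; exact_mod_cast hd)
  have hqb : ∀ d, toLex d < toLex q → coeff d b = 0 := fun d hd =>
    coeff_eq_zero_of_lt_lexOrder (by rw [hq]; exact_mod_cast hd)
  have hpq : p = q := by
    ext i
    have h4 := congrArg (coeff (p + q)) (h' i)
    rw [key _ _ (fun d hd => by rw [hθ, hpa d hd, mul_zero]) hqb,
      key _ _ hpa (fun d hd => by rw [hθ, hqb d hd, mul_zero]), hθ, hθ] at h4
    have h5 : ((p i : ℂ) - q i) * (coeff p a' * coeff q b) = 0 := by linear_combination h4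
    have h6 := (mul_eq_zero.1 h5).resolve_right (mul_ne_zero hap hbq)
    exact_mod_cast sub_eq_zero.1 h6
  exact hap (hpq ▸ hq0)

theorem pullMero_algebraMap (g : FormalDiff n) (φ : FormalSeries n) :
    g.pullMero (algebraMap (FormalSeries n) (FormalMero n) φ) =
      algebraMap (FormalSeries n) (FormalMero n) (g.1.pull φ) :=
  IsFractionRing.ringEquivOfRingEquiv_algebraMap g.pullEquiv.toRingEquiv φ

theorem exists_eq_div (T : FormalMero n) : ∃ a b : FormalSeries n, b ≠ 0 ∧
    T = algebraMap (FormalSeries n) (FormalMero n) a /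
      algebraMap (FormalSeries n) (FormalMero n) b := by
  obtain ⟨a, b, hb, h⟩ := IsFractionRing.div_surjective (A := FormalSeries n) T
  exact ⟨a, b, nonZeroDivisors.ne_zero hb, h.symm⟩

/-- The chain rule `d (T ∘ g) = g^* dT`. -/
theorem pullForm_exactForm (g : FormalDiff n) (T : FormalMero n) :
    pullForm g (exactForm T) = exactForm (g.pullMero T) := by
  obtain ⟨a, b, hb, rfl⟩ := exists_eq_div T
  have hinj := IsFractionRing.injective (FormalSeries n) (FormalMero n)
  have hgb : g.1.pull b ≠ 0 := (map_ne_zero_iff g.pullEquiv g.pullEquiv.injective).2 hb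
  have hgb' : algebraMap (FormalSeries n) (FormalMero n) (g.1.pull b) ≠ 0 :=
    (map_ne_zero_iff _ hinj).2 hgb
  funext i
  rw [pullForm, exactForm, map_div₀, pullMero_algebraMap, pullMero_algebraMap,
    pderivMero_div i _ _ hgb]
  simp only [exactForm, pderivMero_div _ _ _ hb, map_div₀, map_pow, pullMero_algebraMap]
  rw [eq_div_iff (pow_ne_zero 2 hgb'), Finset.sum_mul]
  have : ∀ x y : FormalMero n, x / algebraMap (FormalSeries n) (FormalMero n) (g.1.pull b) ^ 2 * y *
      algebraMap (FormalSeries n) (FormalMero n) (g.1.pull b) ^ 2 = x * y := fun x y => by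
    field_simp
  simp only [this, ← map_mul, ← map_sum]
  congr 1
  simp only [pderiv_pull, map_sub, map_mul, sub_mul, Finset.sum_sub_distrib, Finset.sum_mul,
    Finset.mul_sum]
  congr 1 <;> refine Finset.sum_congr rfl fun j _ => ?_ <;> ring

theorem exists_const_of_exactForm_eq_zero {T : FormalMero n} (h : exactForm T = 0) :
    ∃ c : ℂ, T = algebraMap (FormalSeries n) (FormalMero n) (C c) := by
  obtain ⟨a, b, hb, rfl⟩ := exists_eq_div T
  have hinj := IsFractionRing.injective (FormalSeries n) (FormalMero n)
  have hb' : algebraMap (FormalSeries n) (FormalMero n) b ≠ 0 := (map_ne_zero_iff _ hinj).2 hb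
  obtain ⟨c, rfl⟩ := eq_C_mul_of_pderiv (a := a) hb fun i => by
    have hi := congrFun h i
    rw [exactForm, pderivMero_div i _ _ hb, Pi.zero_apply, div_eq_zero_iff,
      or_iff_left (pow_ne_zero 2 hb'), map_eq_zero_iff _ hinj, sub_eq_zero] at hi
    exact hi
  exact ⟨c, by rw [map_mul, mul_div_cancel_right₀ _ hb']⟩

/-! ### Invariant vector fields and their ratios -/

theorem FormalVectorField.IsInvariant.pull_eq {G : Subgroup (FormalDiff n)}
    {Y : FormalVectorField n} (hY : Y.IsInvariant G) {g : FormalDiff n} (hg : g ∈ G) (i : Fin n) :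
    g.1.pull (Y.1 i) = Y.apply (g.1.comp i) := by
  rw [← congrFun (hY g hg) i, pushforward, ← FormalMap.pull_mul, Units.inv_mul, FormalMap.pull_one]

/-- The ratio of two collinear invariant vector fields is an invariant function. -/
theorem pullMero_eq_of_toMero_eq_smul {G : Subgroup (FormalDiff n)} {Y Z : FormalVectorField n}
    (hY : Y.IsInvariant G) (hZ : Z.IsInvariant G) (hY0 : Y ≠ 0) {T : FormalMero n}
    (hT : Z.toMero = T • Y.toMero) {g : FormalDiff n} (hg : g ∈ G) : g.pullMero T = T := by
  have hinj := IsFractionRing.injective (FormalSeries n) (FormalMero n)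
  have hZT : ∀ i, algebraMap (FormalSeries n) (FormalMero n) (Z.1 i) =
      T * algebraMap (FormalSeries n) (FormalMero n) (Y.1 i) := fun i => congrFun hT i
  obtain ⟨i, hi⟩ : ∃ i, Y.1 i ≠ 0 := by
    by_contra! h
    exact hY0 (Subtype.ext (funext h))
  have hgi : algebraMap (FormalSeries n) (FormalMero n) (g.1.pull (Y.1 i)) ≠ 0 :=
    (map_ne_zero_iff _ hinj).2 ((map_ne_zero_iff g.pullEquiv g.pullEquiv.injective).2 hi)
  -- With `Z = T Y`, invariance gives `Zᵢ ∘ g = Z(gᵢ) = T · Y(gᵢ) = T · (Yᵢ ∘ g)`, while directly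
  -- `Zᵢ ∘ g = (T ∘ g) (Yᵢ ∘ g)`.
  refine mul_right_cancel₀ hgi ?_
  have h1 := congrArg g.pullMero (hZT i)
  rw [map_mul, pullMero_algebraMap, pullMero_algebraMap] at h1
  rw [← h1, hZ.pull_eq hg, hY.pull_eq hg, FormalVectorField.apply, FormalVectorField.apply,
    map_sum, map_sum, Finset.mul_sum]
  refine Finset.sum_congr rfl fun j _ => ?_
  rw [map_mul, map_mul, hZT, mul_assoc]

/-- The ratio `T = Z / Y` is invariant. It has `dT ≠ 0`, since a constant ratio would contradict
independence over `ℂ`. -/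
theorem exists_invariant_exactForm {G : Subgroup (FormalDiff n)} {Y Z : FormalVectorField n}
    (hY : Y.IsInvariant G) (hZ : Z.IsInvariant G) (hi : LinearIndependent ℂ ![Y, Z])
    (hd : ¬ LinearIndependent (FormalMero n) ![Y.toMero, Z.toMero]) :
    ∃ T : FormalMero n, exactForm T ≠ 0 ∧ IsInvariantForm G (exactForm T) := by
  have hinj := IsFractionRing.injective (FormalSeries n) (FormalMero n)
  have hY0 : Y ≠ 0 := hi.ne_zero 0
  have hYm : Y.toMero ≠ 0 := fun h => hY0 <| Subtype.ext <| funext fun i =>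
    (map_eq_zero_iff _ hinj).1 (congrFun h i)
  rw [LinearIndependent.pair_iff' hYm] at hd
  push Not at hd
  obtain ⟨T, hT⟩ := hd
  refine ⟨T, fun h0 => ?_, fun g hg => ?_⟩
  · obtain ⟨c, rfl⟩ := exists_const_of_exactForm_eq_zero h0
    rw [LinearIndependent.pair_iff' hY0] at hi
    refine hi c (Subtype.ext (funext fun i => hinj ?_))
    have := congrFun hT i
    change algebraMap _ _ (C c) * algebraMap _ _ (Y.1 i) = algebraMap _ _ (Z.1 i) at this
    rw [← this, ← map_mul, ← smul_eq_C_mul]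
    rfl
  · rw [pullForm_exactForm, pullMero_eq_of_toMero_eq_smul hY hZ hY0 hT.symm hg]

theorem FormalVectorField.apply_smul (c : ℂ) (Y : FormalVectorField n) (φ : FormalSeries n) :
    (c • Y).apply φ = c • Y.apply φ := by
  rw [apply, apply, Finset.smul_sum]
  exact Finset.sum_congr rfl fun i _ => smul_mul_assoc c (Y.1 i) _

theorem FormalVectorField.apply_map_smul (c : ℂ) (Y : FormalVectorField n) (φ : FormalSeries n) :
    Y.apply (c • φ) = c • Y.apply φ := by
  rw [apply, apply, Finset.smul_sum]
  exact Finset.sum_congr rfl fun i _ => by rw [Derivation.map_smul, mul_smul_comm]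

theorem FormalVectorField.iterate_apply_smul (c : ℂ) (Y : FormalVectorField n)
    (φ : FormalSeries n) (j : ℕ) : (c • Y).apply^[j] φ = c ^ j • Y.apply^[j] φ := by
  induction j with
  | zero => simp
  | succ j ih =>
    rw [Function.iterate_succ_apply', ih, apply_smul, apply_map_smul, smul_smul, pow_succ',
      Function.iterate_succ_apply']

theorem FormalVectorField.IsExp.of_smul {c t : ℂ} {Y : FormalVectorField n} {g : FormalDiff n}
    (h : (c • Y).IsExp t g) : Y.IsExp (t * c) g := by
  intro i d
  refine (h i d).congr_fun fun j => ?_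
  rw [iterate_apply_smul, coeff_smul]
  ring

end Mero

/-- Vectors that are pairwise collinear span at most a line. -/
theorem exists_forall_eq_smul {K V ι : Type*} [Field K] [AddCommGroup V] [Module K V] [Nonempty ι]
    (v : ι → V) (h : ∀ i j, ¬ LinearIndependent K ![v i, v j]) :
    ∃ i, ∀ j, ∃ c : K, v j = c • v i := by
  by_cases h0 : ∀ i, v i = 0
  · exact ⟨Classical.arbitrary ι, fun j => ⟨0, by rw [h0 j, zero_smul]⟩⟩
  · push Not at h0
    obtain ⟨i, hi⟩ := h0
    refine ⟨i, fun j => ?_⟩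
    have := h i j
    rw [LinearIndependent.pair_iff' hi] at this
    push Not at this
    obtain ⟨c, hc⟩ := this
    exact ⟨c, hc.symm⟩

/-! ### The dichotomy for the logarithms of the elements of the group -/

theorem theorem1p5 (G : Subgroup (FormalDiff 2))
    (hconv : ∀ g ∈ G, g.Convergent)
    (htan : ∀ g ∈ G, g.TangentToId)
    (hab : ∀ f ∈ G, ∀ g ∈ G, f * g = g * f) :
    -- `T` formal meromorphic, independence over the field of formal meromorphic functions
    ((∃ T : FormalMero 2, exactForm T ≠ 0 ∧ IsInvariantForm G (exactForm T)) ∨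
      (∃ X ∈ logAlgebra G, EmbedsInFlow G X) ∨
      (∃ X ∈ logAlgebra G, ∃ Y ∈ logAlgebra G,
        LinearIndependent (FormalMero 2) ![X.toMero, Y.toMero] ∧ X.bracket Y = 0 ∧
          X.IsInvariant G ∧ Y.IsInvariant G)) ∧
    -- `T` a quotient of polynomials, independence over `ℂ`
    ((∃ T : FormalMero 2, IsRationalFunction T ∧ exactForm T ≠ 0 ∧
        IsInvariantForm G (exactForm T)) ∨
      (∃ X ∈ logAlgebra G, EmbedsInFlow G X) ∨
      (∃ X ∈ logAlgebra G, ∃ Y ∈ logAlgebra G,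
        LinearIndependent ℂ ![X, Y] ∧ X.bracket Y = 0 ∧
          X.IsInvariant G ∧ Y.IsInvariant G)) := by
  have hinv : ∀ g : G, (htan g g.2).log.IsInvariant G := fun g =>
    (htan g g.2).log_isInvariant fun h hh => hab g g.2 h hh
  have hmem : ∀ g : G, (htan g g.2).log ∈ logAlgebra G := fun g =>
    (htan g g.2).log_mem_logAlgebra g.2
  have hbr : ∀ g h : G, (htan g g.2).log.bracket (htan h h.2).log = 0 := fun g h =>
    (htan g g.2).bracket_log (htan h h.2) (hab g g.2 h h.2)
  by_cases hd : ∃ g h : G, LinearIndependent ℂ ![(htan g g.2).log, (htan h h.2).log]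
  · obtain ⟨g, h, hgh⟩ := hd
    -- A pair independent over `ℂ` already settles the second list; only the first depends on
    -- independence over the meromorphic functions.
    refine ⟨?_, Or.inr (Or.inr ⟨_, hmem g, _, hmem h, hgh, hbr g h, hinv g, hinv h⟩)⟩
    by_cases hK : LinearIndependent (FormalMero 2)
        ![(htan g g.2).log.toMero, (htan h h.2).log.toMero]
    · exact Or.inr (Or.inr ⟨_, hmem g, _, hmem h, hK, hbr g h, hinv g, hinv h⟩)
    · exact Or.inl (exists_invariant_exactForm (hinv g) (hinv h) hgh hK)
  · push Not at hd
    obtain ⟨g, hg⟩ := exists_forall_eq_smul (fun g : G => (htan g g.2).log) hd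
    have hflow : EmbedsInFlow G (htan g g.2).log := fun h hh => by
      obtain ⟨c, hc⟩ := hg ⟨h, hh⟩
      have h1 := (htan h hh).log_isExp_one
      change (htan h hh).log = _ at hc
      rw [hc] at h1
      -- From `log h = c log g` follows `h = exp (c log g)`.
      exact ⟨1 * c, h1.of_smul⟩
    exact ⟨Or.inr (Or.inl ⟨_, hmem g, hflow⟩), Or.inr (Or.inl ⟨_, hmem g, hflow⟩)⟩
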